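/- **Setting.** Fix a signature: types, with decidable equality, of process names, variables, values, expressions, Boolean expressions, procedure names and annotations, together with evaluation functions for expressions and Boolean expressions on a local memory. A state $s$ assigns a value to every variable of every process. *Choreographies* are generated by $C ::= \eta\,@a;C \mid \mathsf{If}\ p\,??\,b\ \mathsf{Then}\ C_1\ \mathsf{Else}\ C_2 \mid \mathsf{Call}\ X \mid \mathsf{RT\_Call}\ X\ ps\ C \mid \mathsf{End}$, where $\eta$ is a value communication $p\#e\to q\$x$ or a label selection $p\to q[\ell]$ with $\ell\in\{\mathrm{left},\mathrm{right}\}$, and $\mathsf{RT\_Call}\ X\ ps\ C$ is the runtime term for a call of $X$ that has evolved to $C$ and that the processes in $ps$ still have to join. A *program* $P=(D,C)$ consists of procedure definitions $D$ (each procedure name $X$ has a list of processes $\mathrm{Vars}(X)$ and a body) and a main choreography $C$. Choreographies have the standard labelled semantics with out-of-order execution of actions of disjoint processes (a conditional may be delayed when both branches can perform the same action), and a procedure is joined by its processes one at a time. The transitions $(P,s)\xrightarrow{t}(P',s')$ carry observable labels $t$: $p$ communicates the value $v$ to $q$; $p$ selects the label $\ell$ at $q$; or an internal step $\tau$ of $p$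 (evaluating a conditional or joining a procedure). *Networks* are maps from processes to behaviours $B$, built from termination, send, receive, selection, branching (an optional annotated behaviour for each of the two labels), conditional and procedure call; a *network program* is a pair of procedure definitions and a network. They have the standard synchronous semantics, with the same observable labels. The *branching order* $B\succeq B'$ is the least relation, compatible with all constructors, under which branching terms on the left may offer additional labels; on networks it is pointwise. *Merging* $B_1\sqcup B_2$ is the corresponding partial join. *Projection* $[\![D,C\mid r]\!]$ is the partial function that maps each action to the action of $r$ in it (skipping those in which $r$ does not take part), a conditional at $p$ to a conditional if $r=p$ and to the merge of the projections of the two branches if $r\neq p$, $\mathsf{Call}\ X$ to $\mathsf{Call}\ (X,r)$ if $r\in\mathrm{Vars}(X)$ and to termination otherwise, and $\mathsf{RT\_Call}\ X\ ps\ C$ to $\mathsf{Call}\ (X,r)$ if $r\in ps$ and to $[\![D,C\mid r]\!]$ otherwise. $P$ is *projectable* if its main choreography has a projection for every process occurring in it and each procedure body has a projection for every process in $\mathrm{Vars}(X)$; then $\mathrm{epp}\,P$ is the network program formed by these projections (termination elsewhere), with procedure names $(X,r)$. $P=(D,C)$ is *well-formed* if there are no self-communications, runtime terms occur only in the main choreography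 and carry nonempty lists $ps\subseteq\mathrm{Vars}(X)$, and every $\mathrm{Vars}(X)$ is nonempty and contains all processes occurring in the body of $X$. $P$ is *strongly projectable* if it is well-formed, all procedure bodies are projectable for their processes, and for every process $r$: every conditional occurring in $C$ has a projection for $r$, and for every runtime term $\mathsf{RT\_Call}\ X\ ps\ C'$ occurring in $C$ and every $p\in ps$, $[\![D,\text{body of }X\mid p]\!]\succeq[\![D,C'\mid p]\!]$ whenever both are defined. Strongly projectable programs are projectable. **Theorem (completeness of endpoint projection).** Let $P$ be a strongly projectable program. 1. If $(P,s)\xrightarrow{t}(P',s')$, then there is a network program $N$ with $(\mathrm{epp}\,P,s)\xrightarrow{t}(N,s')$ such that $N$ has the same procedure definitions as $\mathrm{epp}\,P$, $P'$ is projectable, and the network of $N$ is above the network of $\mathrm{epp}\,P'$ in the branching order. 2. The same holds for multi-step transitions: if $(P,s)\xrightarrow{t_1\cdots t_n}{}^{*}(P',s')$ with $n\ge 0$, then there is $N$ with $(\mathrm{epp}\,P,s)\xrightarrow{t_1\cdots t_n}{}^{*}(N,s')$ such that $N$ has the same procedure definitions as $\mathrm{epp}\,P$, $P'$ is projectable,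 and the network of $N$ is above the network of $\mathrm{epp}\,P'$. -/

import Mathlib

universe u

/-! ## Signatures, states, labels -/

/-- A signature: types with decidable equality for process names, local variables, values,
expressions, Boolean expressions, procedure names and annotations, with evaluation functions
for expressions and Boolean expressions on the local memory `Var → Val` of a process. -/
structure Signature where
  Pid : Type u
  Var : Type u
  Val : Type u
  Expr : Type u
  BExpr : Type u
  RecVar : Type u
  Ann : Type u
  decPid : DecidableEq Pid
  decVar : DecidableEq Var
  decVal : DecidableEq Val
  decExpr : DecidableEq Expr
  decBExpr : DecidableEq BExpr
  decRecVar : DecidableEq RecVar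
  decAnn : DecidableEq Ann
  eval : Expr → (Var → Val) → Val
  beval : BExpr → (Var → Val) → Bool

attribute [instance] Signature.decPid Signature.decVar Signature.decVal Signature.decExpr
  Signature.decBExpr Signature.decRecVar Signature.decAnn

/-- The signature of the target of projection: procedure names are pairs of a procedure name and
a process; everything else is unchanged. -/
abbrev Signature.proj (S : Signature.{u}) : Signature.{u} :=
  { S with
    RecVar := S.RecVar × S.Pid
    decRecVar := inferInstance }

/-- The memory state of all processes. -/
abbrev State (S : Signature.{u}) : Type u := S.Pid → S.Var → S.Val

/-- Extensional equality of states. -/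
def State.Equiv {S : Signature.{u}} (s s' : State S) : Prop := ∀ p x, s p x = s' p x

/-- The state `s` after assigning `v` to the variable `x` of process `q`. -/
def State.update {S : Signature.{u}} (s : State S) (q : S.Pid) (x : S.Var) (v : S.Val) : State S :=
  fun p y => if p = q ∧ y = x then v else s p y

/-- The two selection labels. -/
inductive Label : Type
  | left : Label
  | right : Label

/-- Labels of the lower layer of the semantics. -/
inductive RichLabel (S : Signature.{u}) : Type u
  | com (p : S.Pid) (v : S.Val) (q : S.Pid) (x : S.Var) : RichLabel S
  | sel (p q : S.Pid) (l : Label) : RichLabel S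
  | cond (p : S.Pid) : RichLabel S
  | call (X : S.RecVar) (p : S.Pid) : RichLabel S

/-- Observable labels. They mention process names and values only, so they are literally the
same for a signature `S` and for the projected signature `S.proj`. -/
inductive TransitionLabel (Pid Val : Type u) : Type u
  | com (p : Pid) (v : Val) (q : Pid) : TransitionLabel Pid Val
  | sel (p q : Pid) (l : Label) : TransitionLabel Pid Val
  | tau (p : Pid) : TransitionLabel Pid Val

/-- The observable part of a rich label. -/
def RichLabel.forget {S : Signature.{u}} : RichLabel S → TransitionLabel S.Pid S.Val
  | .com p v q _ => .com p v q
  | .sel p q l => .sel p q l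
  | .cond p => .tau p
  | .call _ p => .tau p

/-- The processes involved in a transition. -/
def RichLabel.pids {S : Signature.{u}} : RichLabel S → List S.Pid
  | .com p _ q _ => [p, q]
  | .sel p q _ => [p, q]
  | .cond p => [p]
  | .call _ p => [p]

/-! Lists of processes represent finite sets: repetitions and order are irrelevant. -/

/-- Number of elements of the set represented by a list. -/
def setSize {α : Type u} [DecidableEq α] (ps : List α) : ℕ := ps.toFinset.card

/-- Removal of `p` from the set represented by a list. -/
def setRemove {α : Type u} [DecidableEq α] (ps : List α) (p : α) : List α :=
  ps.filter (fun q => q ≠ p)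

/-! ## Core Choreographies -/

namespace CC

/-- Interactions: `p#e --> q$x` and `p --> q[l]`. -/
inductive Eta (S : Signature.{u}) : Type u
  | com : S.Pid → S.Expr → S.Pid → S.Var → Eta S
  | sel : S.Pid → S.Pid → Label → Eta S

/-- Choreographies; `nil` is the terminated choreography. -/
inductive Choreography (S : Signature.{u}) : Type u
  | interaction : Eta S → S.Ann → Choreography S → Choreography S
  | cond : S.Pid → S.BExpr → Choreography S → Choreography S → Choreography S
  | call : S.RecVar → Choreography S
  | rtCall : S.RecVar → List S.Pid → Choreography S → Choreography S
  | nil : Choreography S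

/-- Procedure definitions: each procedure has a list of processes and a body. -/
abbrev DefSet (S : Signature.{u}) : Type u := S.RecVar → List S.Pid × Choreography S

structure Program (S : Signature.{u}) : Type u where
  procedures : DefSet S
  main : Choreography S

variable {S : Signature.{u}}

/-- The list of processes of a procedure. -/
def Program.vars (P : Program S) (X : S.RecVar) : List S.Pid := (P.procedures X).1

/-- The body of a procedure. -/
def Program.procs (P : Program S) (X : S.RecVar) : Choreography S := (P.procedures X).2

def Eta.pids : Eta S → List S.Pid
  | .com p _ q _ => [p, q]
  | .sel p q _ => [p, q]

/-- The processes occurring in a choreography, given those used in each procedure. -/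
def Choreography.pn : Choreography S → (S.RecVar → List S.Pid) → List S.Pid
  | .interaction η _ C, V => η.pids ∪ C.pn V
  | .cond p _ C₁ C₂, V => [p] ∪ (C₁.pn V ∪ C₂.pn V)
  | .call X, V => V X
  | .rtCall _ ps C, V => ps ∪ C.pn V
  | .nil, _ => []

/-- The processes occurring in a program. -/
def Program.pn (P : Program S) : List S.Pid := P.main.pn P.vars

/-- No runtime terms. -/
def Choreography.Initial : Choreography S → Prop
  | .interaction _ _ C => C.Initial
  | .cond _ _ C₁ C₂ => C₁.Initial ∧ C₂.Initial
  | .call _ => True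
  | .rtCall _ _ _ => False
  | .nil => True

def Eta.NoSelfComm : Eta S → Prop
  | .com p _ q _ => p ≠ q
  | .sel p q _ => p ≠ q

def Choreography.NoSelfComm : Choreography S → Prop
  | .interaction η _ C => η.NoSelfComm ∧ C.NoSelfComm
  | .cond _ _ C₁ C₂ => C₁.NoSelfComm ∧ C₂.NoSelfComm
  | .call _ => True
  | .rtCall _ _ C => C.NoSelfComm
  | .nil => True

/-- All runtime terms have nonempty lists of processes. -/
def Choreography.NoEmptyAnn : Choreography S → Prop
  | .interaction _ _ C => C.NoEmptyAnn
  | .cond _ _ C₁ C₂ => C₁.NoEmptyAnn ∧ C₂.NoEmptyAnn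
  | .call _ => True
  | .rtCall _ ps C => ps ≠ [] ∧ C.NoEmptyAnn
  | .nil => True

def Choreography.WF (C : Choreography S) : Prop := C.NoSelfComm ∧ C.NoEmptyAnn

/-- In every runtime term of procedure `X`, the listed processes are processes of `X`. -/
def Choreography.Consistent (V : S.RecVar → List S.Pid) : Choreography S → Prop
  | .interaction _ _ C => C.Consistent V
  | .cond _ _ C₁ C₂ => C₁.Consistent V ∧ C₂.Consistent V
  | .call _ => True
  | .rtCall X ps C => ps ⊆ V X ∧ C.Consistent V
  | .nil => True

def Program.WellAnn (P : Program S) (X : S.RecVar) : Prop :=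
  P.vars X ≠ [] ∧ (P.procs X).pn P.vars ⊆ P.vars X

def Program.WF (P : Program S) : Prop :=
  P.main.WF ∧ P.main.Consistent P.vars ∧
    ∀ X, (P.procs X).NoSelfComm ∧ (P.procs X).Initial ∧ P.WellAnn X

/-- Lower layer of the semantics of choreographies: `To D C s t C' s'`. -/
inductive To (D : DefSet S) :
    Choreography S → State S → RichLabel S → Choreography S → State S → Prop
  | com {p e q x a C} {s s' : State S} (v : S.Val) (hv : v = S.eval e (s p))
      (hs : s'.Equiv (s.update q x v)) :
      To D (.interaction (.com p e q x) a C) s (.com p v q x) C s'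
  | sel {p q l a C} {s s' : State S} (hs : s.Equiv s') :
      To D (.interaction (.sel p q l) a C) s (.sel p q l) C s'
  | condThen {p b C₁ C₂} {s s' : State S} (hb : S.beval b (s p) = true) (hs : s.Equiv s') :
      To D (.cond p b C₁ C₂) s (.cond p) C₁ s'
  | condElse {p b C₁ C₂} {s s' : State S} (hb : S.beval b (s p) = false) (hs : s.Equiv s') :
      To D (.cond p b C₁ C₂) s (.cond p) C₂ s'
  | delayEta {η a C C' t} {s s' : State S} (hd : List.Disjoint η.pids t.pids)
      (h : To D C s t C' s') :
      To D (.interaction η a C) s t (.interaction η a C') s'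
  | delayCond {p b C₁ C₂ C₁' C₂' t} {s s' : State S} (hd : p ∉ t.pids)
      (h₁ : To D C₁ s t C₁' s') (h₂ : To D C₂ s t C₂' s') :
      To D (.cond p b C₁ C₂) s t (.cond p b C₁' C₂') s'
  | delayCall {X ps C C' t} {s s' : State S} (hd : List.Disjoint ps t.pids)
      (h : To D C s t C' s') :
      To D (.rtCall X ps C) s t (.rtCall X ps C') s'
  | callLocal {X p} {s s' : State S} (hs : s.Equiv s') (hn : setSize (D X).1 = 1)
      (hp : p ∈ (D X).1) :
      To D (.call X) s (.call X p) (D X).2 s'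
  | callStart {X p} {s s' : State S} (hs : s.Equiv s') (hn : setSize (D X).1 > 1)
      (hp : p ∈ (D X).1) :
      To D (.call X) s (.call X p) (.rtCall X (setRemove (D X).1 p) (D X).2) s'
  | callEnter {X ps p C} {s s' : State S} (hs : s.Equiv s') (hn : setSize ps > 1)
      (hp : p ∈ ps) :
      To D (.rtCall X ps C) s (.call X p) (.rtCall X (setRemove ps p) C) s'
  | callFinish {X ps p C} {s s' : State S} (hs : s.Equiv s') (hn : setSize ps = 1)
      (hp : p ∈ ps) :
      To D (.rtCall X ps C) s (.call X p) C s'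

/-- Configurations: a program with a state. -/
abbrev Configuration (S : Signature.{u}) : Type u := Program S × State S

/-- Middle layer: transitions between configurations. -/
inductive PTo : Configuration S → TransitionLabel S.Pid S.Val → Configuration S → Prop
  | base {D C C' t} {s s' : State S} (h : To D C s t C' s') :
      PTo (⟨D, C⟩, s) t.forget (⟨D, C'⟩, s')

/-- Top layer: multi-step transitions. -/
inductive PToStar :
    Configuration S → List (TransitionLabel S.Pid S.Val) → Configuration S → Prop
  | base {P} {s s' : State S} (hs : s.Equiv s') : PToStar (P, s) [] (P, s')
  | step {c₁ c₂ c₃ t l} (h : PTo c₁ t c₂) (hl : PToStar c₂ l c₃) : PToStar c₁ (t :: l) c₃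

end CC

/-! ## Stateful Processes -/

namespace SP

/-- Behaviours; `nil` is the terminated behaviour. A branching term records the (optional)
annotated behaviours offered for the labels `left` and `right`, in this order. -/
inductive Behaviour (S : Signature.{u}) : Type u
  | nil : Behaviour S
  | send : S.Pid → S.Expr → S.Ann → Behaviour S → Behaviour S
  | recv : S.Pid → S.Var → S.Ann → Behaviour S → Behaviour S
  | sel : S.Pid → Label → S.Ann → Behaviour S → Behaviour S
  | branching : S.Pid → Option (S.Ann × Behaviour S) → Option (S.Ann × Behaviour S) → Behaviour S
  | cond : S.BExpr → Behaviour S → Behaviour S → Behaviour S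
  | call : S.RecVar → Behaviour S

abbrev Network (S : Signature.{u}) : Type u := S.Pid → Behaviour S

abbrev DefSetB (S : Signature.{u}) : Type u := S.RecVar → Behaviour S

structure Program (S : Signature.{u}) : Type u where
  procs : DefSetB S
  net : Network S

variable {S : Signature.{u}}

/-- Extensional equality of networks. -/
def Network.Equiv (N N' : Network S) : Prop := ∀ p, N p = N' p

/-- The singleton network `p[B]`. -/
def Network.single (p : S.Pid) (B : Behaviour S) : Network S :=
  fun q => if q = p then B else .nil

/-- Parallel composition `N | N'` (total; the left network has priority). -/
def Network.par (N N' : Network S) : Network S :=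
  fun p => match N p with
    | .nil => N' p
    | B => B

/-- Removal `N \ p`. -/
def Network.rm (N : Network S) (p : S.Pid) : Network S :=
  fun q => if q = p then .nil else N q

/-- The network `N \ p | p[B]`. -/
def Network.set₁ (N : Network S) (p : S.Pid) (B : Behaviour S) : Network S :=
  Network.par (Network.rm N p) (Network.single p B)

/-- The network `N \ p \ q | p[B] | q[B']`. -/
def Network.set₂ (N : Network S) (p : S.Pid) (B : Behaviour S) (q : S.Pid) (B' : Behaviour S) :
    Network S :=
  Network.par (Network.par (Network.rm (Network.rm N p) q) (Network.single p B))
    (Network.single q B')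

/-- Lower layer of the semantics of networks: `To D N s t N' s'`. -/
inductive To (D : DefSetB S) : Network S → State S → RichLabel S → Network S → State S → Prop
  | com {N N' : Network S} {s s' : State S} {p q e x a a' B B'} (v : S.Val)
      (hp : N p = .send q e a B) (hq : N q = .recv p x a' B') (hv : v = S.eval e (s p))
      (hN : Network.Equiv N' (Network.set₂ N p B q B')) (hs : s'.Equiv (s.update q x v)) :
      To D N s (.com p v q x) N' s'
  | selLeft {N N' : Network S} {s s' : State S} {p q a a' B Bl Br}
      (hp : N p = .sel q .left a B) (hq : N q = .branching p (some (a', Bl)) Br)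
      (hN : Network.Equiv N' (Network.set₂ N p B q Bl)) (hs : s.Equiv s') :
      To D N s (.sel p q .left) N' s'
  | selRight {N N' : Network S} {s s' : State S} {p q a a' B Bl Br}
      (hp : N p = .sel q .right a B) (hq : N q = .branching p Bl (some (a', Br)))
      (hN : Network.Equiv N' (Network.set₂ N p B q Br)) (hs : s.Equiv s') :
      To D N s (.sel p q .right) N' s'
  | condThen {N N' : Network S} {s s' : State S} {p b B₁ B₂}
      (hp : N p = .cond b B₁ B₂) (hb : S.beval b (s p) = true)
      (hN : Network.Equiv N' (Network.set₁ N p B₁)) (hs : s.Equiv s') :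
      To D N s (.cond p) N' s'
  | condElse {N N' : Network S} {s s' : State S} {p b B₁ B₂}
      (hp : N p = .cond b B₁ B₂) (hb : S.beval b (s p) = false)
      (hN : Network.Equiv N' (Network.set₁ N p B₂)) (hs : s.Equiv s') :
      To D N s (.cond p) N' s'
  | call {N N' : Network S} {s s' : State S} {p X} (hp : N p = .call X)
      (hN : Network.Equiv N' (Network.set₁ N p (D X))) (hs : s.Equiv s') :
      To D N s (.call X p) N' s'

abbrev Configuration (S : Signature.{u}) : Type u := Program S × State S

/-- Middle layer: transitions between configurations. -/
inductive PTo : Configuration S → TransitionLabel S.Pid S.Val → Configuration S → Prop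
  | base {D N N' t} {s s' : State S} (h : To D N s t N' s') :
      PTo (⟨D, N⟩, s) t.forget (⟨D, N'⟩, s')

/-- Top layer: multi-step transitions. -/
inductive PToStar :
    Configuration S → List (TransitionLabel S.Pid S.Val) → Configuration S → Prop
  | base {P} {s s' : State S} (hs : s.Equiv s') : PToStar (P, s) [] (P, s')
  | step {c₁ c₂ c₃ t l} (h : PTo c₁ t c₂) (hl : PToStar c₂ l c₃) : PToStar c₁ (t :: l) c₃

/-- The graph of the partial merge operator: `Merge B₁ B₂ B` means that merging `B₁` and `B₂`
is defined and yields `B`. The names of the branching clauses record which of the left and right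
offers of the first and of the second argument are present (`S`) or absent (`N`). -/
inductive Merge : Behaviour S → Behaviour S → Behaviour S → Prop
  | nil : Merge .nil .nil .nil
  | send {p e a B₁ B₂ B} (h : Merge B₁ B₂ B) :
      Merge (.send p e a B₁) (.send p e a B₂) (.send p e a B)
  | recv {p x a B₁ B₂ B} (h : Merge B₁ B₂ B) :
      Merge (.recv p x a B₁) (.recv p x a B₂) (.recv p x a B)
  | sel {p l a B₁ B₂ B} (h : Merge B₁ B₂ B) :
      Merge (.sel p l a B₁) (.sel p l a B₂) (.sel p l a B)
  | branching_NNNN {p} :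
      Merge (.branching p none none) (.branching p none none) (.branching p none none)
  | branching_NNNS {p r} :
      Merge (.branching p none none) (.branching p none (some r)) (.branching p none (some r))
  | branching_NNSN {p l} :
      Merge (.branching p none none) (.branching p (some l) none) (.branching p (some l) none)
  | branching_NNSS {p l r} :
      Merge (.branching p none none) (.branching p (some l) (some r))
        (.branching p (some l) (some r))
  | branching_NSNN {p r} :
      Merge (.branching p none (some r)) (.branching p none none) (.branching p none (some r))
  | branching_NSNS {p aR bR₁ bR₂ bR} (hR : Merge bR₁ bR₂ bR) :
      Merge (.branching p none (some (aR, bR₁))) (.branching p none (some (aR, bR₂)))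
        (.branching p none (some (aR, bR)))
  | branching_NSSN {p l r} :
      Merge (.branching p none (some r)) (.branching p (some l) none)
        (.branching p (some l) (some r))
  | branching_NSSS {p l aR bR₁ bR₂ bR} (hR : Merge bR₁ bR₂ bR) :
      Merge (.branching p none (some (aR, bR₁))) (.branching p (some l) (some (aR, bR₂)))
        (.branching p (some l) (some (aR, bR)))
  | branching_SNNN {p l} :
      Merge (.branching p (some l) none) (.branching p none none) (.branching p (some l) none)
  | branching_SNNS {p l r} :
      Merge (.branching p (some l) none) (.branching p none (some r))
        (.branching p (some l) (some r))
  | branching_SNSN {p aL bL₁ bL₂ bL} (hL : Merge bL₁ bL₂ bL) :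
      Merge (.branching p (some (aL, bL₁)) none) (.branching p (some (aL, bL₂)) none)
        (.branching p (some (aL, bL)) none)
  | branching_SNSS {p aL bL₁ bL₂ bL r} (hL : Merge bL₁ bL₂ bL) :
      Merge (.branching p (some (aL, bL₁)) none) (.branching p (some (aL, bL₂)) (some r))
        (.branching p (some (aL, bL)) (some r))
  | branching_SSNN {p l r} :
      Merge (.branching p (some l) (some r)) (.branching p none none)
        (.branching p (some l) (some r))
  | branching_SSNS {p l aR bR₁ bR₂ bR} (hR : Merge bR₁ bR₂ bR) :
      Merge (.branching p (some l) (some (aR, bR₁))) (.branching p none (some (aR, bR₂)))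
        (.branching p (some l) (some (aR, bR)))
  | branching_SSSN {p aL bL₁ bL₂ bL r} (hL : Merge bL₁ bL₂ bL) :
      Merge (.branching p (some (aL, bL₁)) (some r)) (.branching p (some (aL, bL₂)) none)
        (.branching p (some (aL, bL)) (some r))
  | branching_SSSS {p aL bL₁ bL₂ bL aR bR₁ bR₂ bR} (hL : Merge bL₁ bL₂ bL)
      (hR : Merge bR₁ bR₂ bR) :
      Merge (.branching p (some (aL, bL₁)) (some (aR, bR₁)))
        (.branching p (some (aL, bL₂)) (some (aR, bR₂)))
        (.branching p (some (aL, bL)) (some (aR, bR)))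
  | cond {b Bt₁ Bt₂ Bt Be₁ Be₂ Be} (ht : Merge Bt₁ Bt₂ Bt) (he : Merge Be₁ Be₂ Be) :
      Merge (.cond b Bt₁ Be₁) (.cond b Bt₂ Be₂) (.cond b Bt Be)
  | call {X} : Merge (.call X) (.call X) (.call X)

/-- The branching order: `MoreBranches B B'` is `B [>>] B'`. -/
inductive MoreBranches : Behaviour S → Behaviour S → Prop
  | nil : MoreBranches .nil .nil
  | send {p e a B B'} (h : MoreBranches B B') :
      MoreBranches (.send p e a B) (.send p e a B')
  | recv {p x a B B'} (h : MoreBranches B B') :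
      MoreBranches (.recv p x a B) (.recv p x a B')
  | sel {p l a B B'} (h : MoreBranches B B') :
      MoreBranches (.sel p l a B) (.sel p l a B')
  | branching_NN {p mBl mBr} :
      MoreBranches (.branching p mBl mBr) (.branching p none none)
  | branching_NS {p mBl a Br Br'} (h : MoreBranches Br Br') :
      MoreBranches (.branching p mBl (some (a, Br))) (.branching p none (some (a, Br')))
  | branching_SN {p a Bl Bl' mBr} (h : MoreBranches Bl Bl') :
      MoreBranches (.branching p (some (a, Bl)) mBr) (.branching p (some (a, Bl')) none)
  | branching_SS {p a Bl Bl' a' Br Br'} (hl : MoreBranches Bl Bl') (hr : MoreBranches Br Br') :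
      MoreBranches (.branching p (some (a, Bl)) (some (a', Br)))
        (.branching p (some (a, Bl')) (some (a', Br')))
  | cond {b B₁ B₁' B₂ B₂'} (h₁ : MoreBranches B₁ B₁') (h₂ : MoreBranches B₂ B₂') :
      MoreBranches (.cond b B₁ B₂) (.cond b B₁' B₂')
  | call {X} : MoreBranches (.call X) (.call X)

/-- Pointwise extension of the branching order to networks. -/
def MoreBranchesN (N N' : Network S) : Prop := ∀ p, MoreBranches (N p) (N' p)

end SP

/-! ## Endpoint projection -/

namespace EPP

open CC SP

variable {S : Signature.{u}}

/-- The graph of the partial projection: `BProj D C r B` means that the projection of `C` for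
process `r` is defined and equals `B`. -/
inductive BProj (D : DefSet S) : Choreography S → S.Pid → Behaviour S.proj → Prop
  | nil {p} : BProj D .nil p .nil
  | send {p e q x a C B} (h : BProj D C p B) :
      BProj D (.interaction (.com p e q x) a C) p (.send q e a B)
  | recv {p e q x a C B} (hpq : p ≠ q) (h : BProj D C q B) :
      BProj D (.interaction (.com p e q x) a C) q (.recv p x a B)
  | com {p e q x a C r B} (hp : p ≠ r) (hq : q ≠ r) (h : BProj D C r B) :
      BProj D (.interaction (.com p e q x) a C) r B
  | pick {p q l a C B} (h : BProj D C p B) :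
      BProj D (.interaction (.sel p q l) a C) p (.sel q l a B)
  | left {p q a C B} (hpq : p ≠ q) (h : BProj D C q B) :
      BProj D (.interaction (.sel p q .left) a C) q (.branching p (some (a, B)) none)
  | right {p q a C B} (hpq : p ≠ q) (h : BProj D C q B) :
      BProj D (.interaction (.sel p q .right) a C) q (.branching p none (some (a, B)))
  | sel {p q l a C r B} (hp : p ≠ r) (hq : q ≠ r) (h : BProj D C r B) :
      BProj D (.interaction (.sel p q l) a C) r B
  | cond {p b C₁ C₂ B₁ B₂} (h₁ : BProj D C₁ p B₁) (h₂ : BProj D C₂ p B₂) :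
      BProj D (.cond p b C₁ C₂) p (.cond b B₁ B₂)
  | cond' {p b C₁ C₂ r B₁ B₂ B} (hp : p ≠ r) (h₁ : BProj D C₁ r B₁) (h₂ : BProj D C₂ r B₂)
      (hm : Merge B₁ B₂ B) :
      BProj D (.cond p b C₁ C₂) r B
  | call_in {X p} (hp : p ∈ (D X).1) : BProj D (.call X) p (.call (X, p))
  | call_out {X p} (hp : p ∉ (D X).1) : BProj D (.call X) p .nil
  | rtCall_in {X ps C p} (hp : p ∈ ps) : BProj D (.rtCall X ps C) p (.call (X, p))
  | rtCall_out {X ps C p B} (hp : p ∉ ps) (h : BProj D C p B) : BProj D (.rtCall X ps C) p B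

def ProjectableB (D : DefSet S) (C : Choreography S) (p : S.Pid) : Prop := ∃ B, BProj D C p B

def ProjectableC (D : DefSet S) (C : Choreography S) (ps : List S.Pid) : Prop :=
  ∀ p ∈ ps, ProjectableB D C p

def ProjectableD (D : DefSet S) : Prop := ∀ X, ProjectableC D (D X).2 (D X).1

def ProjectableP (P : CC.Program S) : Prop :=
  ProjectableC P.procedures P.main P.pn ∧ ProjectableD P.procedures

/-- The network projecting `C` for the processes in `ps`; other processes are terminated. -/
noncomputable def eppC (D : DefSet S) (ps : List S.Pid) (C : Choreography S)
    (h : ProjectableC D C ps) : Network S.proj :=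
  fun p => if hp : p ∈ ps then (h p hp).choose else .nil

/-- The projected procedures: `(X, p)` is the projection for `p` of the body of `X` if `p` is
a process of `X`, and terminated otherwise. -/
noncomputable def eppD (D : DefSet S) (h : ProjectableD D) : DefSetB S.proj :=
  fun Xp => eppC D (D Xp.1).1 (D Xp.1).2 (h Xp.1) Xp.2

/-- Endpoint projection of a program. -/
noncomputable def epp (P : CC.Program S) (h : ProjectableP P) : SP.Program S.proj where
  procs := eppD P.procedures h.2
  net := eppC P.procedures P.pn P.main h.1

/-- Strong projectability of a choreography for a process. -/
def StrProj (D : DefSet S) : Choreography S → S.Pid → Prop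
  | .interaction _ _ C, r => StrProj D C r
  | .cond p b C₁ C₂, r => StrProj D C₁ r ∧ StrProj D C₂ r ∧ ProjectableB D (.cond p b C₁ C₂) r
  | .call _, _ => True
  | .rtCall X ps C, r => StrProj D C r ∧
      ∀ p ∈ ps, ∀ B B', BProj D (D X).2 p B → BProj D C p B' → MoreBranches B B'
  | .nil, _ => True

/-- Strong projectability of a program. -/
def StrProjP (P : CC.Program S) : Prop :=
  P.WF ∧ ProjectableD P.procedures ∧ ∀ r, StrProj P.procedures P.main r

theorem StrProj.projectableB {D : DefSet S} {C : Choreography S} {r : S.Pid}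
    (h : StrProj D C r) : ProjectableB D C r := by
  induction C with
  | interaction η a C ih =>
    obtain ⟨B, hB⟩ := ih h
    cases η with
    | com p e q x =>
      by_cases hp : p = r
      · subst hp
        exact ⟨_, .send hB⟩
      · by_cases hq : q = r
        · subst hq
          exact ⟨_, .recv hp hB⟩
        · exact ⟨_, .com hp hq hB⟩
    | sel p q l =>
      by_cases hp : p = r
      · subst hp
        exact ⟨_, .pick hB⟩
      · by_cases hq : q = r
        · subst hq
          cases l
          · exact ⟨_, .left hp hB⟩
          · exact ⟨_, .right hp hB⟩
        · exact ⟨_, .sel hp hq hB⟩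
  | cond p b C₁ C₂ _ _ => exact h.2.2
  | call X =>
    by_cases hr : r ∈ (D X).1
    · exact ⟨_, .call_in hr⟩
    · exact ⟨_, .call_out hr⟩
  | rtCall X ps C ih =>
    by_cases hr : r ∈ ps
    · exact ⟨_, .rtCall_in hr⟩
    · obtain ⟨B, hB⟩ := ih h.1
      exact ⟨_, .rtCall_out hr hB⟩
  | nil => exact ⟨_, .nil⟩

/-- Strong projectability implies projectability, so a strongly projectable program has an
endpoint projection. -/
theorem StrProjP.projectableP {P : CC.Program S} (h : StrProjP P) : ProjectableP P :=
  ⟨fun p _ => (h.2.2 p).projectableB, h.2.1⟩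

end EPP

/-! A network transition is a pointwise affair: the label fixes what each process must do, and
processes outside the label stand still. `LocalStep` records the contribution of one process, and
`to_of_localStep` reassembles these contributions into a transition. Completeness thus reduces to
one process at a time: `BProj.localStep` shows that if `C` moves to `C'`, the projection of `C` for
`r` makes the matching local step to a behaviour above a projection of `C'`. The existence of that
projection is part of the claim.

The order is unavoidable, since a process not evaluating a conditional keeps the merge of both
branches while the choreography keeps only one. The hard case is a delayed conditional, where the
projections of the two branches move separately and must still be mergeable. This holds because
merging is a join: a merge bounds both arguments, and any two behaviours with a common upper bound
have a merge below it (`exists_merge`). Local steps are deterministic and are simulated by larger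
behaviours (`unique`, `mono`), so the merge moves to one behaviour above both results.

For a process joining a procedure that has already evolved, strong projectability says exactly that
the projected body lies above the projection of the evolved choreography. Strong projectability is
itself invariant (`strProj_of_to`), again by `BProj.localStep`. Multi-step transitions follow by
induction, started from an arbitrary network above the projection. -/

namespace SP

variable {S : Signature.{u}}

/-! ### The branching order and merging as its join -/

theorem MoreBranches.refl : ∀ B : Behaviour S, MoreBranches B B
  | .nil => .nil
  | .send _ _ _ B => .send (refl B)
  | .recv _ _ _ B => .recv (refl B)
  | .sel _ _ _ B => .sel (refl B)
  | .branching _ none none => .branching_NN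
  | .branching _ none (some (_, Br)) => .branching_NS (refl Br)
  | .branching _ (some (_, Bl)) none => .branching_SN (refl Bl)
  | .branching _ (some (_, Bl)) (some (_, Br)) => .branching_SS (refl Bl) (refl Br)
  | .cond _ B₁ B₂ => .cond (refl B₁) (refl B₂)
  | .call _ => .call

theorem MoreBranches.trans {A B C : Behaviour S} (h₁ : MoreBranches A B)
    (h₂ : MoreBranches B C) : MoreBranches A C := by
  induction h₁ generalizing C with
  | nil => exact h₂
  | send _ ih => cases h₂ with | send h => exact .send (ih h)
  | recv _ ih => cases h₂ with | recv h => exact .recv (ih h)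
  | sel _ ih => cases h₂ with | sel h => exact .sel (ih h)
  | branching_NN => cases h₂; exact .branching_NN
  | branching_NS _ ih =>
    cases h₂ with
    | branching_NN => exact .branching_NN
    | branching_NS h => exact .branching_NS (ih h)
  | branching_SN _ ih =>
    cases h₂ with
    | branching_NN => exact .branching_NN
    | branching_SN h => exact .branching_SN (ih h)
  | branching_SS _ _ ihl ihr =>
    cases h₂ with
    | branching_NN => exact .branching_NN
    | branching_NS h => exact .branching_NS (ihr h)
    | branching_SN h => exact .branching_SN (ihl h)
    | branching_SS hl hr => exact .branching_SS (ihl hl) (ihr hr)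
  | cond _ _ ih₁ ih₂ => cases h₂ with | cond h h' => exact .cond (ih₁ h) (ih₂ h')
  | call => exact h₂

/-- Together with its right-hand twin and `exists_merge`, this makes the merge a least upper bound,
which is all that the proof uses about merging besides functionality. -/
theorem Merge.moreBranches_left {B₁ B₂ B : Behaviour S} (h : Merge B₁ B₂ B) :
    MoreBranches B B₁ := by
  induction h <;> first
    | exact .refl _
    | (constructor <;> first | assumption | exact .refl _)

theorem Merge.moreBranches_right {B₁ B₂ B : Behaviour S} (h : Merge B₁ B₂ B) :
    MoreBranches B B₂ := by
  induction h <;> first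
    | exact .refl _
    | (constructor <;> first | assumption | exact .refl _)

theorem Merge.unique {B₁ B₂ B B' : Behaviour S} (h : Merge B₁ B₂ B) (h' : Merge B₁ B₂ B') :
    B = B' := by
  induction h generalizing B' <;> cases h' <;> grind

/-- Two behaviours with a common upper bound in the branching order can be merged, and the
result is below that bound. -/
theorem MoreBranches.exists_merge {B B₁ B₂ : Behaviour S} (h₁ : MoreBranches B B₁)
    (h₂ : MoreBranches B B₂) : ∃ M, Merge B₁ B₂ M ∧ MoreBranches B M := by
  induction h₁ generalizing B₂ with
  | nil => cases h₂; exact ⟨_, .nil, .nil⟩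
  | send _ ih =>
    cases h₂ with | send h =>
    obtain ⟨M, hM, hB⟩ := ih h
    exact ⟨_, .send hM, .send hB⟩
  | recv _ ih =>
    cases h₂ with | recv h =>
    obtain ⟨M, hM, hB⟩ := ih h
    exact ⟨_, .recv hM, .recv hB⟩
  | sel _ ih =>
    cases h₂ with | sel h =>
    obtain ⟨M, hM, hB⟩ := ih h
    exact ⟨_, .sel hM, .sel hB⟩
  | branching_NN =>
    cases h₂ with
    | branching_NN => exact ⟨_, .branching_NNNN, .branching_NN⟩
    | branching_NS h => exact ⟨_, .branching_NNNS, .branching_NS h⟩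
    | branching_SN h => exact ⟨_, .branching_NNSN, .branching_SN h⟩
    | branching_SS hl hr => exact ⟨_, .branching_NNSS, .branching_SS hl hr⟩
  | branching_NS h₁ ih =>
    cases h₂ with
    | branching_NN => exact ⟨_, .branching_NSNN, .branching_NS h₁⟩
    | branching_NS h =>
      obtain ⟨M, hM, hB⟩ := ih h
      exact ⟨_, .branching_NSNS hM, .branching_NS hB⟩
    -- The two sides offer different labels, so nothing has to be merged; the bound already carries
    -- both offers.
    | branching_SN h => exact ⟨_, .branching_NSSN, .branching_SS h h₁⟩
    | branching_SS hl hr =>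
      obtain ⟨M, hM, hB⟩ := ih hr
      exact ⟨_, .branching_NSSS hM, .branching_SS hl hB⟩
  | branching_SN h₁ ih =>
    cases h₂ with
    | branching_NN => exact ⟨_, .branching_SNNN, .branching_SN h₁⟩
    | branching_NS h => exact ⟨_, .branching_SNNS, .branching_SS h₁ h⟩
    | branching_SN h =>
      obtain ⟨M, hM, hB⟩ := ih h
      exact ⟨_, .branching_SNSN hM, .branching_SN hB⟩
    | branching_SS hl hr =>
      obtain ⟨M, hM, hB⟩ := ih hl
      exact ⟨_, .branching_SNSS hM, .branching_SS hB hr⟩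
  | branching_SS h₁ h₁' ihl ihr =>
    cases h₂ with
    | branching_NN => exact ⟨_, .branching_SSNN, .branching_SS h₁ h₁'⟩
    | branching_NS h =>
      obtain ⟨M, hM, hB⟩ := ihr h
      exact ⟨_, .branching_SSNS hM, .branching_SS h₁ hB⟩
    | branching_SN h =>
      obtain ⟨M, hM, hB⟩ := ihl h
      exact ⟨_, .branching_SSSN hM, .branching_SS hB h₁'⟩
    | branching_SS hl hr =>
      obtain ⟨M, hM, hB⟩ := ihl hl
      obtain ⟨M', hM', hB'⟩ := ihr hr
      exact ⟨_, .branching_SSSS hM hM', .branching_SS hB hB'⟩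
  | cond _ _ ih₁ ih₂ =>
    cases h₂ with | cond h h' =>
    obtain ⟨M, hM, hB⟩ := ih₁ h
    obtain ⟨M', hM', hB'⟩ := ih₂ h'
    exact ⟨_, .cond hM hM', .cond hB hB'⟩
  | call => cases h₂; exact ⟨_, .call, .call⟩

/-! ### Pointwise description of network updates -/

theorem Network.set₁_apply (N : Network S) (p : S.Pid) (B : Behaviour S) (r : S.Pid) :
    N.set₁ p B r = if r = p then B else N r := by
  unfold Network.set₁ Network.par Network.rm Network.single
  by_cases h : r = p
  · simp [h]
  · simp only [h, if_false]
    split <;> simp_all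

/-- `par` falls through to its right argument wherever the left one is `nil`. If `p = q` and `B` is
`nil`, the update would yield `B'` at `p`; hence the hypothesis `hpq`. -/
theorem Network.set₂_apply (N : Network S) {p q : S.Pid} (hpq : p ≠ q) (B B' : Behaviour S)
    (r : S.Pid) :
    N.set₂ p B q B' r = if r = p then B else if r = q then B' else N r := by
  unfold Network.set₂ Network.par Network.rm Network.single
  by_cases h : r = p
  · subst h
    simp only [hpq, if_false, if_true]
    split <;> simp_all
  · by_cases h' : r = q
    · subst h'
      simp [h]
    · simp only [h, h', if_false]
      cases N r <;> rfl

end SP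

/-! ### Local steps of a single process -/

namespace EPP

open CC SP

variable {S : Signature.{u}}

/-- The contribution of a process to a transition: `LocalStep Q s t r B B'` means that, in
state `s` and with procedures `Q`, process `r` evolves from `B` to `B'` in a transition of the
network labelled `t`. -/
inductive LocalStep (Q : DefSetB S.proj) (s : State S) :
    RichLabel S → S.Pid → Behaviour S.proj → Behaviour S.proj → Prop
  | idle {t r B} (hr : r ∉ t.pids) : LocalStep Q s t r B B
  | send {p v q x e a B} (hpq : p ≠ q) (hv : v = S.eval e (s p)) :
      LocalStep Q s (.com p v q x) p (.send q e a B) B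
  | recv {p v q x a B} (hpq : p ≠ q) : LocalStep Q s (.com p v q x) q (.recv p x a B) B
  | pick {p q l a B} (hpq : p ≠ q) : LocalStep Q s (.sel p q l) p (.sel q l a B) B
  | left {p q a B mBr} (hpq : p ≠ q) :
      LocalStep Q s (.sel p q .left) q (.branching p (some (a, B)) mBr) B
  | right {p q a B mBl} (hpq : p ≠ q) :
      LocalStep Q s (.sel p q .right) q (.branching p mBl (some (a, B))) B
  | condThen {p b B₁ B₂} (hb : S.beval b (s p) = true) :
      LocalStep Q s (.cond p) p (.cond b B₁ B₂) B₁
  | condElse {p b B₁ B₂} (hb : S.beval b (s p) = false) :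
      LocalStep Q s (.cond p) p (.cond b B₁ B₂) B₂
  | call {X p} : LocalStep Q s (.call X p) p (.call (X, p)) (Q (X, p))

theorem LocalStep.eq_of_notMem {Q : DefSetB S.proj} {s : State S} {t : RichLabel S} {r : S.Pid}
    {B B' : Behaviour S.proj} (h : LocalStep Q s t r B B') (hr : r ∉ t.pids) : B' = B := by
  cases h <;> simp_all [RichLabel.pids]

/-- Behaviours offering more branches simulate local steps. -/
theorem LocalStep.mono {Q : DefSetB S.proj} {s : State S} {t : RichLabel S} {r : S.Pid}
    {A B B' : Behaviour S.proj} (h : LocalStep Q s t r B B') (hA : MoreBranches A B) :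
    ∃ A', LocalStep Q s t r A A' ∧ MoreBranches A' B' := by
  cases h with
  | idle hr => exact ⟨A, .idle hr, hA⟩
  | send hpq hv => cases hA with | send h => exact ⟨_, .send hpq hv, h⟩
  | recv hpq => cases hA with | recv h => exact ⟨_, .recv hpq, h⟩
  | pick hpq => cases hA with | sel h => exact ⟨_, .pick hpq, h⟩
  | left hpq =>
    cases hA with
    | branching_SN h => exact ⟨_, .left hpq, h⟩
    | branching_SS h _ => exact ⟨_, .left hpq, h⟩
  | right hpq =>
    cases hA with
    | branching_NS h => exact ⟨_, .right hpq, h⟩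
    | branching_SS _ h => exact ⟨_, .right hpq, h⟩
  | condThen hb => cases hA with | cond h _ => exact ⟨_, .condThen hb, h⟩
  | condElse hb => cases hA with | cond _ h => exact ⟨_, .condElse hb, h⟩
  | call => cases hA; exact ⟨_, .call, .refl _⟩

/-- The label decides whether `r` is idle and which branch a selection takes, and the value of the
guard in `s` decides a conditional; nothing is left to choose. -/
theorem LocalStep.unique {Q : DefSetB S.proj} {s : State S} {t : RichLabel S} {r : S.Pid}
    {B B₁ B₂ : Behaviour S.proj} (h₁ : LocalStep Q s t r B B₁) (h₂ : LocalStep Q s t r B B₂) :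
    B₁ = B₂ := by
  cases h₁ <;> cases h₂ <;> simp_all [RichLabel.pids]

/-- A local step of two mergeable behaviours is a local step of their merge, to a common upper
bound of the results. -/
theorem LocalStep.merge {Q : DefSetB S.proj} {s : State S} {t : RichLabel S} {r : S.Pid}
    {A B M A' B' : Behaviour S.proj} (hA : LocalStep Q s t r A A') (hB : LocalStep Q s t r B B')
    (hM : Merge A B M) :
    ∃ M', LocalStep Q s t r M M' ∧ MoreBranches M' A' ∧ MoreBranches M' B' := by
  obtain ⟨M₁, h₁, h₁'⟩ := hA.mono hM.moreBranches_left
  obtain ⟨M₂, h₂, h₂'⟩ := hB.mono hM.moreBranches_right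
  -- Each argument of the merge lifts its own step to `M`; determinism makes the two lifted results
  -- the same behaviour, hence a common bound.
  obtain rfl := h₁.unique h₂
  exact ⟨_, h₁, h₁', h₂'⟩

/-! ### Basic properties of projection -/

/-- `epp` selects projections by choice; uniqueness identifies the selected behaviour with any one
derived by the rules. The side conditions keep the rules apart, and `Merge.unique` settles the
conditional. -/
theorem BProj.unique {D : DefSet S} {C : Choreography S} {r : S.Pid} {B B' : Behaviour S.proj}
    (h : BProj D C r B) (h' : BProj D C r B') : B = B' := by
  induction h generalizing B' with
  | cond' hp _ _ hm ih₁ ih₂ =>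
    cases h' with
    | cond _ _ => exact absurd rfl hp
    | cond' _ h₁ h₂ hm' =>
      obtain rfl := ih₁ h₁
      obtain rfl := ih₂ h₂
      exact hm.unique hm'
  | _ => cases h' <;> grind

/-- `eppC` puts `nil` outside its list of processes by fiat. Here this is seen to be the true
projection, so later arguments can range over all processes. At a conditional, the merge of `nil`
with `nil` is used. -/
theorem BProj.nil_of_notMem_pn {D : DefSet S} {V : S.RecVar → List S.Pid}
    (hV : ∀ X, V X = (D X).1) {C : Choreography S} {r : S.Pid} (hr : r ∉ C.pn V) :
    BProj D C r .nil := by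
  induction C with
  | interaction η a C ih =>
    cases η with
    | com p e q x =>
      simp only [Choreography.pn, Eta.pids, List.mem_union_iff, List.mem_cons] at hr
      exact .com (by grind) (by grind) (ih (by grind))
    | sel p q l =>
      simp only [Choreography.pn, Eta.pids, List.mem_union_iff, List.mem_cons] at hr
      exact .sel (by grind) (by grind) (ih (by grind))
  | cond p b C₁ C₂ ih₁ ih₂ =>
    simp only [Choreography.pn, List.mem_union_iff, List.mem_cons] at hr
    exact .cond' (by grind) (ih₁ (by grind)) (ih₂ (by grind)) .nil
  | call X => exact .call_out (by simpa [Choreography.pn, hV] using hr)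
  | rtCall X ps C ih =>
    simp only [Choreography.pn, List.mem_union_iff] at hr
    exact .rtCall_out (by grind) (ih (by grind))
  | nil => exact .nil

theorem ProjectableB.of_interaction {D : DefSet S} {η : Eta S} {a : S.Ann} {C : Choreography S}
    {r : S.Pid} (h : ProjectableB D (.interaction η a C) r) : ProjectableB D C r := by
  obtain ⟨B, hB⟩ := h
  cases hB <;> exact ⟨_, by assumption⟩

theorem ProjectableB.of_cond {D : DefSet S} {p : S.Pid} {b : S.BExpr} {C₁ C₂ : Choreography S}
    {r : S.Pid} (h : ProjectableB D (.cond p b C₁ C₂) r) :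
    ProjectableB D C₁ r ∧ ProjectableB D C₂ r := by
  obtain ⟨B, hB⟩ := h
  cases hB <;> exact ⟨⟨_, by assumption⟩, ⟨_, by assumption⟩⟩

/-- Projectability implies strong projectability in the absence of runtime terms. -/
theorem ProjectableB.strProj {D : DefSet S} {C : Choreography S} {r : S.Pid} (hC : C.Initial)
    (h : ProjectableB D C r) : StrProj D C r := by
  induction C with
  | interaction η a C ih => exact ih hC h.of_interaction
  | cond p b C₁ C₂ ih₁ ih₂ => exact ⟨ih₁ hC.1 h.of_cond.1, ih₂ hC.2 h.of_cond.2, h⟩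
  | call X => trivial
  | rtCall X ps C => exact hC.elim
  | nil => trivial

theorem _root_.CC.Choreography.Initial.noEmptyAnn {C : Choreography S} (h : C.Initial) :
    C.NoEmptyAnn := by
  induction C with
  | interaction η a C ih => exact ih h
  | cond p b C₁ C₂ ih₁ ih₂ => exact ⟨ih₁ h.1, ih₂ h.2⟩
  | call X => trivial
  | rtCall X ps C => exact h.elim
  | nil => trivial

theorem _root_.CC.Choreography.Initial.consistent {C : Choreography S} (h : C.Initial)
    (V : S.RecVar → List S.Pid) : C.Consistent V := by
  induction C with
  | interaction η a C ih => exact ih h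
  | cond p b C₁ C₂ ih₁ ih₂ => exact ⟨ih₁ h.1, ih₂ h.2⟩
  | call X => trivial
  | rtCall X ps C => exact h.elim
  | nil => trivial

/-! ### Lists as finite sets -/

theorem mem_setRemove {α : Type u} [DecidableEq α] {ps : List α} {p q : α} :
    q ∈ setRemove ps p ↔ q ∈ ps ∧ q ≠ p := by
  simp [setRemove]

theorem eq_of_setSize_eq_one {α : Type u} [DecidableEq α] {ps : List α} {p q : α}
    (h : setSize ps = 1) (hp : p ∈ ps) (hq : q ∈ ps) : q = p :=
  Finset.card_le_one.mp h.le q (List.mem_toFinset.mpr hq) p (List.mem_toFinset.mpr hp)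

theorem setRemove_ne_nil {α : Type u} [DecidableEq α] {ps : List α} (p : α)
    (h : setSize ps > 1) : setRemove ps p ≠ [] := by
  obtain ⟨q, hq, hqp⟩ := Finset.exists_mem_ne h p
  exact List.ne_nil_of_mem (mem_setRemove.mpr ⟨List.mem_toFinset.mp hq, hqp⟩)

/-! ### From local steps to network transitions -/

/-- The effect of a transition on the state. -/
def StateStep (s : State S) : RichLabel S → State S → Prop
  | .com _ v q x, s' => s'.Equiv (s.update q x v)
  | .sel _ _ _, s' => s.Equiv s'
  | .cond _, s' => s.Equiv s'
  | .call _ _, s' => s.Equiv s'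

/-- The delay rules pass on the label and the states of the inner transition, so the change of state
depends on the label alone, as it does for networks. -/
theorem stateStep_of_to {D : DefSet S} {C C' : Choreography S} {s s' : State S} {t : RichLabel S}
    (h : CC.To D C s t C' s') : StateStep s t s' := by
  induction h <;> assumption

/-- The label of the network transition that corresponds to a choreography transition. -/
def projLabel : RichLabel S → RichLabel S.proj
  | .com p v q x => .com p v q x
  | .sel p q l => .sel p q l
  | .cond p => .cond p
  | .call X p => .call (X, p) p

theorem forget_projLabel (t : RichLabel S) : (projLabel t).forget = t.forget := by
  cases t <;> rfl

/-- Local steps of all processes make up a transition of the network. -/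
theorem to_of_localStep {Q : DefSetB S.proj} {s s' : State S} {t : RichLabel S}
    {N N' : Network S.proj} (h : ∀ r, LocalStep Q s t r (N r) (N' r)) (hs : StateStep s t s') :
    SP.To Q N s (projLabel t) N' s' := by
  have hrest : ∀ r, r ∉ t.pids → N' r = N r := fun r hr => (h r).eq_of_notMem hr
  cases t with
  | com p v q x =>
    have hp := h p
    have hq := h q
    generalize hA : N p = A, hA' : N' p = A' at hp
    generalize hB : N q = B, hB' : N' q = B' at hq
    -- `p ≠ q` is only extracted from the local steps below, so the update is prepared
    -- conditionally.
    have hset : p ≠ q → Network.Equiv N' (Network.set₂ N p A' q B') := by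
      intro hpq r
      rw [Network.set₂_apply N hpq]
      have := hrest r
      simp only [RichLabel.pids, List.mem_cons] at this
      grind
    cases hp with
    | idle hr => simp [RichLabel.pids] at hr
    -- The sender acting as receiver would be a self-communication.
    | recv hpq => exact absurd rfl hpq
    | send hpq hv =>
      cases hq with
      | idle hr => simp [RichLabel.pids] at hr
      | send hpq => exact absurd rfl hpq
      | recv _ =>
        exact SP.To.com (S := S.proj) (N := N) (N' := N') (p := p) (q := q) v hA hB hv
          (hset hpq) hs
  | sel p q l =>
    have hp := h p
    have hq := h q
    generalize hA : N p = A, hA' : N' p = A' at hp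
    generalize hB : N q = B, hB' : N' q = B' at hq
    have hset : p ≠ q → Network.Equiv N' (Network.set₂ N p A' q B') := by
      intro hpq r
      rw [Network.set₂_apply N hpq]
      have := hrest r
      simp only [RichLabel.pids, List.mem_cons] at this
      grind
    cases hp with
    | idle hr => simp [RichLabel.pids] at hr
    | left hpq => exact absurd rfl hpq
    | right hpq => exact absurd rfl hpq
    | pick hpq =>
      cases hq with
      | idle hr => simp [RichLabel.pids] at hr
      | pick hpq => exact absurd rfl hpq
      | left _ => exact .selLeft hA hB (hset hpq) hs
      | right _ => exact .selRight hA hB (hset hpq) hs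
  | cond p =>
    have hp := h p
    generalize hA : N p = A, hA' : N' p = A' at hp
    have hset : Network.Equiv N' (Network.set₁ N p A') := by
      intro r
      rw [Network.set₁_apply]
      have := hrest r
      simp only [RichLabel.pids, List.mem_cons] at this
      grind
    cases hp with
    | idle hr => simp [RichLabel.pids] at hr
    | condThen hb => exact .condThen hA hb hset hs
    | condElse hb => exact .condElse hA hb hset hs
  | call X p =>
    have hp := h p
    generalize hA : N p = A, hA' : N' p = A' at hp
    have hset : Network.Equiv N' (Network.set₁ N p A') := by
      intro r
      rw [Network.set₁_apply]
      have := hrest r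
      simp only [RichLabel.pids, List.mem_cons] at this
      grind
    cases hp with
    | idle hr => simp [RichLabel.pids] at hr
    | call => exact .call hA hset hs

/-! ### Projections follow choreography transitions -/

/-- Every process follows a transition of a choreography locally, ending above its projection of
the result. -/
theorem BProj.localStep {D : DefSet S} {Q : DefSetB S.proj}
    (hpn : ∀ X, (D X).2.pn (fun Y => (D Y).1) ⊆ (D X).1)
    (hQ : ∀ X, ∀ p ∈ (D X).1, BProj D (D X).2 p (Q (X, p)))
    {C C' : Choreography S} {s s' : State S} {t : RichLabel S} (h : CC.To D C s t C' s')
    (hns : C.NoSelfComm) (hcons : C.Consistent fun Y => (D Y).1) (hstr : ∀ r, StrProj D C r)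
    {r : S.Pid} {B : Behaviour S.proj} (hB : BProj D C r B) :
    ∃ B₁ B', LocalStep Q s t r B B₁ ∧ BProj D C' r B' ∧ MoreBranches B₁ B' := by
  -- A process outside a procedure does not occur in its body, so unfolding the call leaves its
  -- projection `nil`.
  have hout : ∀ X r, r ∉ (D X).1 → BProj D (D X).2 r .nil := fun X r hr =>
    BProj.nil_of_notMem_pn (fun _ => rfl) fun h => hr (hpn X h)
  induction h generalizing B with
  | com v hv hs =>
    cases hB with
    | send h => exact ⟨_, _, .send hns.1 hv, h, .refl _⟩
    | recv hpq h => exact ⟨_, _, .recv hpq, h, .refl _⟩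
    | com hp hq h =>
      exact ⟨_, _, .idle (by simp [RichLabel.pids, hp.symm, hq.symm]), h, .refl _⟩
  | sel hs =>
    cases hB with
    | pick h => exact ⟨_, _, .pick hns.1, h, .refl _⟩
    | left hpq h => exact ⟨_, _, .left hpq, h, .refl _⟩
    | right hpq h => exact ⟨_, _, .right hpq, h, .refl _⟩
    | sel hp hq h =>
      exact ⟨_, _, .idle (by simp [RichLabel.pids, hp.symm, hq.symm]), h, .refl _⟩
  | condThen hb hs =>
    cases hB with
    | cond h₁ h₂ => exact ⟨_, _, .condThen hb, h₁, .refl _⟩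
    | cond' hp h₁ h₂ hm =>
      -- An onlooker keeps the whole merge, which is only above the projection of the chosen branch.
      exact ⟨_, _, .idle (by simp [RichLabel.pids, hp.symm]), h₁, hm.moreBranches_left⟩
  | condElse hb hs =>
    cases hB with
    | cond h₁ h₂ => exact ⟨_, _, .condElse hb, h₂, .refl _⟩
    | cond' hp h₁ h₂ hm =>
      exact ⟨_, _, .idle (by simp [RichLabel.pids, hp.symm]), h₂, hm.moreBranches_right⟩
  | delayEta hd _ ih =>
    have ih := fun B hB => ih hns.2 hcons hstr (B := B) hB
    -- A process of the delayed interaction is not in the label, so its continuation is unchanged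
    -- and its prefix can be put back. Other processes do not see the interaction.
    have hidle : r ∈ Eta.pids _ → r ∉ _ := fun h => hd h
    cases hB with
    | send h =>
      obtain ⟨B₁, B', hl, h', hm⟩ := ih _ h
      have hr := hidle (by simp [Eta.pids])
      obtain rfl := hl.eq_of_notMem hr
      exact ⟨_, _, .idle hr, .send h', .send hm⟩
    | recv hpq h =>
      obtain ⟨B₁, B', hl, h', hm⟩ := ih _ h
      have hr := hidle (by simp [Eta.pids])
      obtain rfl := hl.eq_of_notMem hr
      exact ⟨_, _, .idle hr, .recv hpq h', .recv hm⟩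
    | pick h =>
      obtain ⟨B₁, B', hl, h', hm⟩ := ih _ h
      have hr := hidle (by simp [Eta.pids])
      obtain rfl := hl.eq_of_notMem hr
      exact ⟨_, _, .idle hr, .pick h', .sel hm⟩
    | left hpq h =>
      obtain ⟨B₁, B', hl, h', hm⟩ := ih _ h
      have hr := hidle (by simp [Eta.pids])
      obtain rfl := hl.eq_of_notMem hr
      exact ⟨_, _, .idle hr, .left hpq h', .branching_SN hm⟩
    | right hpq h =>
      obtain ⟨B₁, B', hl, h', hm⟩ := ih _ h
      have hr := hidle (by simp [Eta.pids])
      obtain rfl := hl.eq_of_notMem hr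
      exact ⟨_, _, .idle hr, .right hpq h', .branching_NS hm⟩
    | com hp hq h =>
      obtain ⟨B₁, B', hl, h', hm⟩ := ih _ h
      exact ⟨_, _, hl, .com hp hq h', hm⟩
    | sel hp hq h =>
      obtain ⟨B₁, B', hl, h', hm⟩ := ih _ h
      exact ⟨_, _, hl, .sel hp hq h', hm⟩
  | delayCond hd _ _ ih₁ ih₂ =>
    have ih₁ := fun B hB => ih₁ hns.1 hcons.1 (fun r => (hstr r).1) (B := B) hB
    have ih₂ := fun B hB => ih₂ hns.2 hcons.2 (fun r => (hstr r).2.1) (B := B) hB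
    cases hB with
    | cond h₁ h₂ =>
      obtain ⟨A₁, A', hl, h₁', hm⟩ := ih₁ _ h₁
      obtain ⟨B₁, B', hl', h₂', hm'⟩ := ih₂ _ h₂
      obtain rfl := hl.eq_of_notMem hd
      obtain rfl := hl'.eq_of_notMem hd
      exact ⟨_, _, .idle hd, .cond h₁' h₂', .cond hm hm'⟩
    | cond' hp h₁ h₂ hM =>
      obtain ⟨A₁, A', hl, h₁', hm⟩ := ih₁ _ h₁
      obtain ⟨B₁, B', hl', h₂', hm'⟩ := ih₂ _ h₂
      -- `M₁` bounds both stepped branches, hence also the projections of `C₁'` and `C₂'` below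
      -- them; these are therefore mergeable, and the new conditional is projectable for `r`.
      obtain ⟨M₁, hstep, hA, hB⟩ := hl.merge hl' hM
      obtain ⟨M', hM', hle⟩ := (hA.trans hm).exists_merge (hB.trans hm')
      exact ⟨_, _, hstep, .cond' hp h₁' h₂' hM', hle⟩
  | delayCall hd _ ih =>
    cases hB with
    | rtCall_in hp => exact ⟨_, _, .idle (hd hp), .rtCall_in hp, .refl _⟩
    | rtCall_out hp h =>
      obtain ⟨B₁, B', hl, h', hm⟩ := ih hns hcons.2 (fun r => (hstr r).1) h
      exact ⟨_, _, hl, .rtCall_out hp h', hm⟩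
  | @callLocal X p s s' hs hn hp =>
    cases hB with
    | call_in hr =>
      obtain rfl := eq_of_setSize_eq_one hn hp hr
      exact ⟨_, _, .call, hQ _ _ hr, .refl _⟩
    | call_out hr =>
      have : r ≠ p := fun h => hr (h ▸ hp)
      exact ⟨_, _, .idle (by simpa [RichLabel.pids] using this), hout _ _ hr, .refl _⟩
  | @callStart X p s s' hs hn hp =>
    cases hB with
    | call_in hr =>
      by_cases hrp : r = p
      · subst hrp
        exact ⟨_, _, .call, .rtCall_out (by simp [mem_setRemove]) (hQ _ _ hr), .refl _⟩
      · exact ⟨_, _, .idle (by simpa [RichLabel.pids] using hrp),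
          .rtCall_in (mem_setRemove.mpr ⟨hr, hrp⟩), .refl _⟩
    | call_out hr =>
      have : r ≠ p := fun h => hr (h ▸ hp)
      exact ⟨_, _, .idle (by simpa [RichLabel.pids] using this),
        .rtCall_out (fun h => hr (mem_setRemove.mp h).1) (hout _ _ hr), .refl _⟩
  | @callEnter X ps p C s s' hs hn hp =>
    cases hB with
    | rtCall_in hr =>
      by_cases hrp : r = p
      · subst hrp
        obtain ⟨B', hB'⟩ := (hstr r).1.projectableB
        exact ⟨_, _, .call, .rtCall_out (by simp [mem_setRemove]) hB',
          -- The joining process starts from the original body while the choreography has moved on;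
          -- the runtime clause of strong projectability compares the two.
          (hstr r).2 r hr _ _ (hQ _ _ (hcons.1 hr)) hB'⟩
      · exact ⟨_, _, .idle (by simpa [RichLabel.pids] using hrp),
          .rtCall_in (mem_setRemove.mpr ⟨hr, hrp⟩), .refl _⟩
    | rtCall_out hr h =>
      have : r ≠ p := fun h => hr (h ▸ hp)
      exact ⟨_, _, .idle (by simpa [RichLabel.pids] using this),
        .rtCall_out (fun h => hr (mem_setRemove.mp h).1) h, .refl _⟩
  | @callFinish X ps p C s s' hs hn hp =>
    cases hB with
    | rtCall_in hr =>
      obtain rfl := eq_of_setSize_eq_one hn hp hr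
      obtain ⟨B', hB'⟩ := (hstr r).1.projectableB
      exact ⟨_, _, .call, hB', (hstr r).2 r hr _ _ (hQ _ _ (hcons.1 hr)) hB'⟩
    | rtCall_out hr h =>
      have : r ≠ p := fun h => hr (h ▸ hp)
      exact ⟨_, _, .idle (by simpa [RichLabel.pids] using this), h, .refl _⟩

/-! ### Invariance of strong projectability -/

theorem eppC_of_mem {D : DefSet S} {ps : List S.Pid} {C : Choreography S}
    (h : ProjectableC D C ps) {p : S.Pid} (hp : p ∈ ps) : BProj D C p (eppC D ps C h p) := by
  simp only [eppC, hp, dif_pos]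
  exact (h p hp).choose_spec

theorem bproj_eppD {D : DefSet S} (h : ProjectableD D) (X : S.RecVar) (p : S.Pid)
    (hp : p ∈ (D X).1) : BProj D (D X).2 p (eppD D h (X, p)) :=
  eppC_of_mem (h X) hp

theorem bproj_epp (P : CC.Program S) (h : ProjectableP P) (r : S.Pid) :
    BProj P.procedures P.main r ((epp P h).net r) := by
  by_cases hr : r ∈ P.pn
  · exact eppC_of_mem h.1 hr
  · have : (epp P h).net r = .nil := by simp [epp, eppC, hr]
    rw [this]
    exact .nil_of_notMem_pn (V := P.vars) (fun _ => rfl) hr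

/-- Bodies contain no runtime terms, so projectability suffices. It is assumed for the processes of
`X`, and all others project to `nil`. -/
theorem strProj_body {P : CC.Program S} (hP : StrProjP P) (X : S.RecVar) (r : S.Pid) :
    StrProj P.procedures (P.procedures X).2 r := by
  refine ProjectableB.strProj (hP.1.2.2 X).2.1 ?_
  by_cases hr : r ∈ (P.procedures X).1
  · exact hP.2.1 X r hr
  · exact ⟨_, .nil_of_notMem_pn (V := P.vars) (fun _ => rfl)
      fun h => hr ((hP.1.2.2 X).2.2.2 h)⟩

theorem noSelfComm_of_to {D : DefSet S} (hD : ∀ X, (D X).2.NoSelfComm)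
    {C C' : Choreography S} {s s' : State S} {t : RichLabel S} (h : CC.To D C s t C' s')
    (hC : C.NoSelfComm) : C'.NoSelfComm := by
  induction h with
  | com | sel => exact hC.2
  | condThen => exact hC.1
  | condElse => exact hC.2
  | delayEta _ _ ih => exact ⟨hC.1, ih hC.2⟩
  | delayCond _ _ _ ih₁ ih₂ => exact ⟨ih₁ hC.1, ih₂ hC.2⟩
  | delayCall _ _ ih => exact ih hC
  | callLocal | callStart => exact hD _
  | callEnter | callFinish => exact hC

theorem noEmptyAnn_of_to {D : DefSet S} (hD : ∀ X, (D X).2.Initial)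
    {C C' : Choreography S} {s s' : State S} {t : RichLabel S} (h : CC.To D C s t C' s')
    (hC : C.NoEmptyAnn) : C'.NoEmptyAnn := by
  induction h with
  | com | sel => exact hC
  | condThen => exact hC.1
  | condElse => exact hC.2
  | delayEta _ _ ih => exact ih hC
  | delayCond _ _ _ ih₁ ih₂ => exact ⟨ih₁ hC.1, ih₂ hC.2⟩
  | delayCall _ _ ih => exact ⟨hC.1, ih hC.2⟩
  | callLocal => exact (hD _).noEmptyAnn
  | callStart _ hn => exact ⟨setRemove_ne_nil _ hn, (hD _).noEmptyAnn⟩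
  | callEnter _ hn => exact ⟨setRemove_ne_nil _ hn, hC.2⟩
  | callFinish => exact hC.2

theorem consistent_of_to {D : DefSet S} (hD : ∀ X, (D X).2.Initial)
    {C C' : Choreography S} {s s' : State S} {t : RichLabel S} (h : CC.To D C s t C' s')
    (hC : C.Consistent fun X => (D X).1) : C'.Consistent fun X => (D X).1 := by
  induction h with
  | com | sel => exact hC
  | condThen => exact hC.1
  | condElse => exact hC.2
  | delayEta _ _ ih => exact ih hC
  | delayCond _ _ _ ih₁ ih₂ => exact ⟨ih₁ hC.1, ih₂ hC.2⟩
  | delayCall _ _ ih => exact ⟨hC.1, ih hC.2⟩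
  | callLocal => exact (hD _).consistent _
  | callStart => exact ⟨fun _ h => (mem_setRemove.mp h).1, (hD _).consistent _⟩
  | callEnter => exact ⟨fun _ h => hC.1 (mem_setRemove.mp h).1, hC.2⟩
  | callFinish => exact hC.2

/-- Only two clauses need an argument. A delayed conditional stays projectable by `BProj.localStep`.
For a delayed runtime term, the processes still to join are not in the label, so their old
projection lies above the new one, and transitivity applies. `P` supplies only the procedures; `C`
is independent of its main choreography, so that the induction can enter subterms. -/
theorem strProj_of_to {P : CC.Program S} (hP : StrProjP P)
    {C C' : Choreography S} {s s' : State S} {t : RichLabel S}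
    (h : CC.To P.procedures C s t C' s') (hns : C.NoSelfComm)
    (hcons : C.Consistent fun X => (P.procedures X).1) (hstr : ∀ r, StrProj P.procedures C r)
    (r : S.Pid) : StrProj P.procedures C' r := by
  have hstep {C C' : Choreography S} {s s' : State S} {t : RichLabel S}
      (h : CC.To P.procedures C s t C' s') (hns : C.NoSelfComm)
      (hcons : C.Consistent fun X => (P.procedures X).1)
      (hstr : ∀ r, StrProj P.procedures C r) {r : S.Pid} {B : Behaviour S.proj}
      (hB : BProj P.procedures C r B) :=
    BProj.localStep (fun X => (hP.1.2.2 X).2.2.2) (bproj_eppD hP.2.1) h hns hcons hstr hB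
  induction h generalizing r with
  | com | sel => exact hstr r
  | condThen => exact (hstr r).1
  | condElse => exact (hstr r).2.1
  | delayEta _ _ ih => exact ih hns.2 hcons hstr r
  | delayCond hd h₁ h₂ ih₁ ih₂ =>
    refine ⟨ih₁ hns.1 hcons.1 (fun r => (hstr r).1) r,
      ih₂ hns.2 hcons.2 (fun r => (hstr r).2.1) r, ?_⟩
    obtain ⟨B, hB⟩ := (hstr r).2.2
    obtain ⟨_, B', _, hB', _⟩ := hstep (.delayCond hd h₁ h₂) hns hcons hstr hB
    exact ⟨B', hB'⟩
  | delayCall hd h ih =>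
    have hstr' := fun r => (hstr r).1
    refine ⟨ih hns hcons.2 hstr' r, fun p hp B B' hB hB' => ?_⟩
    obtain ⟨A, hA⟩ := (hstr' p).projectableB
    obtain ⟨A₁, A', hl, hA', hm⟩ := hstep h hns hcons.2 hstr' hA
    obtain rfl := hl.eq_of_notMem (hd hp)
    obtain rfl := hA'.unique hB'
    exact ((hstr r).2 p hp _ _ hB hA).trans hm
  | callLocal => exact strProj_body hP _ r
  | callStart =>
    refine ⟨strProj_body hP _ r, fun p _ B B' hB hB' => ?_⟩
    -- The call has just been unfolded, so both behaviours are projections of the same body.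
    obtain rfl := hB.unique hB'
    exact .refl _
  | callEnter =>
    exact ⟨(hstr r).1, fun p hp => (hstr r).2 p (mem_setRemove.mp hp).1⟩
  | callFinish => exact (hstr r).1

/-- Strong projectability is preserved by transitions. -/
theorem StrProjP.of_to {D : DefSet S} {C C' : Choreography S} (hP : StrProjP ⟨D, C⟩)
    {s s' : State S} {t : RichLabel S} (h : CC.To D C s t C' s') : StrProjP ⟨D, C'⟩ := by
  obtain ⟨⟨⟨hns, hne⟩, hcons, hD⟩, hproj, hstr⟩ := id hP
  exact ⟨⟨⟨noSelfComm_of_to (fun X => (hD X).1) h hns,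
    noEmptyAnn_of_to (fun X => (hD X).2.1) h hne⟩,
    consistent_of_to (fun X => (hD X).2.1) h hcons, hD⟩, hproj,
    strProj_of_to hP h hns hcons hstr⟩

/-! ### Simulation by networks above the projection -/

/-- Networks above the projection of a program follow its transitions. -/
theorem exists_pto_of_pto {P P' : CC.Program S} {s s' : State S}
    {tl : TransitionLabel S.Pid S.Val} (h : CC.PTo (P, s) tl (P', s')) (hP : StrProjP P)
    {N : Network S.proj} (hN : MoreBranchesN N (epp P hP.projectableP).net) :
    ∃ N' : Network S.proj,
      SP.PTo (⟨(epp P hP.projectableP).procs, N⟩, s) tl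
        (⟨(epp P hP.projectableP).procs, N'⟩, s') ∧
      ∃ hP' : StrProjP P', (epp P' hP'.projectableP).procs = (epp P hP.projectableP).procs ∧
        MoreBranchesN N' (epp P' hP'.projectableP).net := by
  cases h with
  | @base D C C' t _ _ h =>
    have hP' := hP.of_to h
    have key : ∀ r, ∃ A, LocalStep (eppD D hP.2.1) s t r (N r) A ∧
        MoreBranches A ((epp ⟨D, C'⟩ hP'.projectableP).net r) := by
      intro r
      obtain ⟨B₁, B', hl, hB', hm⟩ := BProj.localStep (fun X => (hP.1.2.2 X).2.2.2)
        (bproj_eppD hP.2.1) h hP.1.1.1 hP.1.2.1 hP.2.2 (bproj_epp _ hP.projectableP r)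
      -- The step of the exact projection is lifted to the larger behaviour `N r`.
      obtain ⟨A, hA, hAm⟩ := hl.mono (hN r)
      obtain rfl := hB'.unique (bproj_epp ⟨D, C'⟩ hP'.projectableP r)
      exact ⟨A, hA, hAm.trans hm⟩
    choose N' hl hm using key
    -- The projected procedures depend only on `D`, which a transition does not change; hence `rfl`.
    refine ⟨N', ?_, hP', rfl, hm⟩
    rw [← forget_projLabel t]
    exact .base (to_of_localStep hl (stateStep_of_to h))

/-- Networks above the projection of a program follow its multi-step transitions. -/
theorem exists_ptoStar_of_ptoStar {P P' : CC.Program S} {s s' : State S}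
    {ts : List (TransitionLabel S.Pid S.Val)} (h : CC.PToStar (P, s) ts (P', s'))
    (hP : StrProjP P) {N : Network S.proj}
    (hN : MoreBranchesN N (epp P hP.projectableP).net) :
    ∃ N' : Network S.proj,
      SP.PToStar (⟨(epp P hP.projectableP).procs, N⟩, s) ts
        (⟨(epp P hP.projectableP).procs, N'⟩, s') ∧
      ∃ hP' : ProjectableP P', MoreBranchesN N' (epp P' hP').net := by
  generalize hc : (P, s) = c, hc' : (P', s') = c' at h
  -- `N` must vary: after one step the network is only known to be above the projection, not equal
  -- to it.
  induction h generalizing P s N with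
  | base hs =>
    obtain ⟨rfl, rfl⟩ := Prod.mk.inj hc
    obtain ⟨rfl, rfl⟩ := Prod.mk.inj hc'
    exact ⟨N, .base hs, hP.projectableP, hN⟩
  | @step c₁ c₂ c₃ t l h _ ih =>
    subst hc
    obtain ⟨P₂, s₂⟩ := c₂
    obtain ⟨N₂, hstep, hP₂, hprocs, hN₂⟩ := exists_pto_of_pto h hP hN
    obtain ⟨N', hstar, hP', hN'⟩ := ih hP₂ hN₂ rfl hc'
    rw [hprocs] at hstar
    exact ⟨N', .step hstep hstar, hP', hN'⟩

end EPP

/-- Completeness of endpoint projection, for single and for multi-step transitions.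
(Proofs of projectability are propositions, so `epp P h` does not depend on `h`.) -/
theorem mainTheorem2 {S : Signature.{u}} (P : CC.Program S) (hP : EPP.StrProjP P)
    (s : State S) (P' : CC.Program S) (s' : State S) :
    (∀ tl : TransitionLabel S.Pid S.Val, CC.PTo (P, s) tl (P', s') →
      ∃ N : SP.Program S.proj,
        SP.PTo (EPP.epp P hP.projectableP, s) tl (N, s') ∧
        N.procs = (EPP.epp P hP.projectableP).procs ∧
        ∃ hP' : EPP.ProjectableP P', SP.MoreBranchesN N.net (EPP.epp P' hP').net) ∧
    (∀ ts : List (TransitionLabel S.Pid S.Val), CC.PToStar (P, s) ts (P', s') →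
      ∃ N : SP.Program S.proj,
        SP.PToStar (EPP.epp P hP.projectableP, s) ts (N, s') ∧
        N.procs = (EPP.epp P hP.projectableP).procs ∧
        ∃ hP' : EPP.ProjectableP P', SP.MoreBranchesN N.net (EPP.epp P' hP').net) := by
  have hN : SP.MoreBranchesN (EPP.epp P hP.projectableP).net (EPP.epp P hP.projectableP).net :=
    fun _ => .refl _
  refine ⟨fun tl h => ?_, fun ts h => ?_⟩
  · obtain ⟨N', hstep, hP', _, hN'⟩ := EPP.exists_pto_of_pto h hP hN
    exact ⟨⟨_, N'⟩, hstep, rfl, hP'.projectableP, hN'⟩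
  · obtain ⟨N', hstar, hP', hN'⟩ := EPP.exists_ptoStar_of_ptoStar h hP hN
    exact ⟨⟨_, N'⟩, hstar, rfl, hP', hN'⟩
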